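/- Let $\mathfrak{A}$ be a (not necessarily unital) $C^*$-algebra and let $H$, $K$ be Hilbert $\mathfrak{A}$-modules (complete for the norm $\|x\|=\|\langle x,x\rangle\|^{1/2}$). Write $\mathcal{L}(H,K)$ for the set of adjointable operators from $H$ to $K$, i.e. the maps $B:H\to K$ for which there is a map $B^*:K\to H$ with $\langle Bx,y\rangle=\langle x,B^*y\rangle$ for all $x\in H$, $y\in K$, and put $\mathcal{L}(H)=\mathcal{L}(H,H)$, which is a $C^*$-algebra. For $B\in\mathcal{L}(H,K)$ let $|B|=(B^*B)^{1/2}\in\mathcal{L}(H)$ be the positive square root of $B^*B$. For $B,U\in\mathcal{L}(H,K)$ we say that $B=U|B|$ is the polar decomposition of $B$ if $U$ is a partial isometry (that is, $U^*U$ is a projection), $B=U|B|$, and $U^*U$ is the orthogonal projection of $H$ onto the closure $\overline{\mathcal{R}(B^*)}$ of the range of $B^*$; and $B$ has the polar decomposition if such a $U$ exists. **Theorem.** Let $T\in\mathcal{L}(K)$ and $S\in\mathcal{L}(H)$ have the polar decompositions $T=U_T|T|$ and $S=U_S|S|$. Let $A\in\mathcal{L}(H,K)$ be arbitrary and put $$X=TAS\qquad\text{and}\qquad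 Y=|T|\,A\,|S^*|.$$ (i) If $X=U_X|X|$ is the polar decomposition of $X$, then $Y=U_T^*U_XU_S^*\,|Y|$ is the polar decomposition of $Y$. (ii) If $Y=U_Y|Y|$ is the polar decomposition of $Y$, then $X=U_TU_YU_S\,|X|$ is the polar decomposition of $X$. In particular, $X$ has the polar decomposition if and only if $Y$ does. -/

import Mathlib

open scoped InnerProductSpace

noncomputable section

/-! ## Adjointable operators between Hilbert C⋆-modules

A Hilbert `𝔄`-module is a `CStarModule 𝔄 H` whose norm is complete. -/

section General

variable (𝔄 H K L : Type*) [NonUnitalCStarAlgebra 𝔄] [PartialOrder 𝔄] [StarOrderedRing 𝔄]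
  [NormedAddCommGroup H] [NormedSpace ℂ H] [SMul 𝔄 H] [CStarModule 𝔄 H]
  [NormedAddCommGroup K] [NormedSpace ℂ K] [SMul 𝔄 K] [CStarModule 𝔄 K]
  [NormedAddCommGroup L] [NormedSpace ℂ L] [SMul 𝔄 L] [CStarModule 𝔄 L]

/-- The adjointable operators from `H` to `K`, as a linear subspace of the bounded operators.
(On Hilbert C⋆-modules every map possessing an adjoint is linear and bounded, see
`Adjointable.exists_of_map` below.) -/
def adjointableSubmodule : Submodule ℂ (H →L[ℂ] K) where
  carrier := {T | ∃ S : K → H, ∀ x y, ⟪T x, y⟫_𝔄 = ⟪x, S y⟫_𝔄}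
  add_mem' := by
    rintro T₁ T₂ ⟨S₁, h₁⟩ ⟨S₂, h₂⟩
    exact ⟨fun y => S₁ y + S₂ y, fun x y => by simp [h₁, h₂]⟩
  zero_mem' := ⟨fun _ => 0, fun x y => by simp⟩
  smul_mem' := by
    rintro c T ⟨S, h⟩
    exact ⟨fun y => star c • S y, fun x y => by simp [h]⟩

/-- `𝓛(H, K)`, the space of adjointable operators from `H` to `K`. -/
abbrev Adjointable := ↥(adjointableSubmodule 𝔄 H K)

variable {𝔄 H K L}

/-- Two vectors with the same inner products against all vectors are equal. -/
theorem CStarModule.ext_inner_left' {u v : H} (h : ∀ x : H, ⟪x, u⟫_𝔄 = ⟪x, v⟫_𝔄) : u = v := by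
  rw [← sub_eq_zero, ← CStarModule.inner_self (A := 𝔄), CStarModule.inner_sub_right, h, sub_self]

/-- The (unique) adjoint `T⋆ : K → H`, as a bounded linear map. -/
def Adjointable.adjCLM (T : Adjointable 𝔄 H K) : K →L[ℂ] H :=
  LinearMap.mkContinuous
    { toFun := T.2.choose
      map_add' := fun y z => CStarModule.ext_inner_left' (𝔄 := 𝔄) fun x => by
        rw [CStarModule.inner_add_right, ← T.2.choose_spec, ← T.2.choose_spec,
          ← T.2.choose_spec, CStarModule.inner_add_right]
      map_smul' := fun c y => CStarModule.ext_inner_left' (𝔄 := 𝔄) fun x => by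
        rw [RingHom.id_apply, CStarModule.inner_smul_right_complex, ← T.2.choose_spec,
          ← T.2.choose_spec, CStarModule.inner_smul_right_complex] }
    ‖T.1‖ (fun y => by
      change ‖T.2.choose y‖ ≤ ‖T.1‖ * ‖y‖
      set s := T.2.choose y with hs
      rcases (norm_nonneg s).eq_or_lt with h0 | h0
      · rw [← h0]; positivity
      · refine le_of_mul_le_mul_left ?_ h0
        calc ‖s‖ * ‖s‖ = ‖⟪s, s⟫_𝔄‖ := by rw [← CStarModule.norm_sq_eq 𝔄, sq]
          _ = ‖⟪T.1 s, y⟫_𝔄‖ := by rw [T.2.choose_spec]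
          _ ≤ ‖T.1 s‖ * ‖y‖ := CStarModule.norm_inner_le K
          _ ≤ (‖T.1‖ * ‖s‖) * ‖y‖ := by gcongr; exact T.1.le_opNorm s
          _ = ‖s‖ * (‖T.1‖ * ‖y‖) := by ring)

theorem Adjointable.inner_adjCLM (T : Adjointable 𝔄 H K) (x : H) (y : K) :
    ⟪T.1 x, y⟫_𝔄 = ⟪x, T.adjCLM y⟫_𝔄 := T.2.choose_spec x y

theorem Adjointable.inner_adjCLM_left (T : Adjointable 𝔄 H K) (x : H) (y : K) :
    ⟪T.adjCLM y, x⟫_𝔄 = ⟪y, T.1 x⟫_𝔄 := by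
  rw [← CStarModule.star_inner, ← T.inner_adjCLM, CStarModule.star_inner]

/-- The adjoint operator `T⋆ ∈ 𝓛(K, H)` of `T ∈ 𝓛(H, K)`. -/
def Adjointable.adj (T : Adjointable 𝔄 H K) : Adjointable 𝔄 K H :=
  ⟨T.adjCLM, T.1, fun y x => T.inner_adjCLM_left x y⟩

/-- The composition `T ∘ S` of adjointable operators. -/
def Adjointable.comp (T : Adjointable 𝔄 K L) (S : Adjointable 𝔄 H K) : Adjointable 𝔄 H L :=
  ⟨T.1.comp S.1, fun z => S.adjCLM (T.adjCLM z), fun x z => by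
    rw [ContinuousLinearMap.comp_apply, T.inner_adjCLM, S.inner_adjCLM]⟩

/-- The adjoint is determined by its defining identity. -/
theorem Adjointable.adj_eq {T : Adjointable 𝔄 H K} {S : Adjointable 𝔄 K H}
    (h : ∀ x y, ⟪T.1 x, y⟫_𝔄 = ⟪x, S.1 y⟫_𝔄) : T.adj = S :=
  Subtype.ext <| ContinuousLinearMap.ext fun y =>
    CStarModule.ext_inner_left' (𝔄 := 𝔄) fun x => (T.inner_adjCLM x y).symm.trans (h x y)

theorem Adjointable.inner_adj (T : Adjointable 𝔄 H K) (x : H) (y : K) :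
    ⟪T.1 x, y⟫_𝔄 = ⟪x, T.adj.1 y⟫_𝔄 := T.inner_adjCLM x y

theorem Adjointable.inner_adj_left (T : Adjointable 𝔄 H K) (x : H) (y : K) :
    ⟪T.adj.1 y, x⟫_𝔄 = ⟪y, T.1 x⟫_𝔄 := T.inner_adjCLM_left x y

theorem Adjointable.adj_adj (T : Adjointable 𝔄 H K) : T.adj.adj = T :=
  Adjointable.adj_eq fun y x => T.inner_adj_left x y

theorem Adjointable.norm_adj_le (T : Adjointable 𝔄 H K) : ‖T.adj‖ ≤ ‖T‖ :=
  by
  refine T.adj.1.opNorm_le_bound (norm_nonneg T.1) fun y => ?_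
  exact (T.adjCLM.le_opNorm y).trans
    (mul_le_mul_of_nonneg_right (LinearMap.mkContinuous_norm_le _ (norm_nonneg _) _)
      (norm_nonneg y))

theorem Adjointable.norm_adj (T : Adjointable 𝔄 H K) : ‖T.adj‖ = ‖T‖ :=
  le_antisymm T.norm_adj_le (by simpa only [T.adj_adj] using T.adj.norm_adj_le)

theorem Adjointable.adj_sub (T S : Adjointable 𝔄 H K) : (T - S).adj = T.adj - S.adj :=
  Adjointable.adj_eq fun x y => by
    simp only [Submodule.coe_sub, sub_apply, CStarModule.inner_sub_left,
      CStarModule.inner_sub_right, Adjointable.inner_adj]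

/-- A map between Hilbert C⋆-modules that possesses an adjoint is an element of `𝓛(H, K)`. -/
theorem Adjointable.exists_of_map [CompleteSpace H] [CompleteSpace K] (t : H → K) (s : K → H)
    (h : ∀ x y, ⟪t x, y⟫_𝔄 = ⟪x, s y⟫_𝔄) : ∃ T : Adjointable 𝔄 H K, ∀ x, T.1 x = t x := by
  have h' : ∀ x y, ⟪y, t x⟫_𝔄 = ⟪s y, x⟫_𝔄 := fun x y => by
    rw [← CStarModule.star_inner, h, CStarModule.star_inner]
  let g : H →ₗ[ℂ] K :=
    { toFun := t
      map_add' := fun x z => CStarModule.ext_inner_left' (𝔄 := 𝔄) fun y => by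
        simp only [CStarModule.inner_add_right, h']
      map_smul' := fun c x => CStarModule.ext_inner_left' (𝔄 := 𝔄) fun y => by
        simp only [RingHom.id_apply, CStarModule.inner_smul_right_complex, h'] }
  refine ⟨⟨ContinuousLinearMap.ofSeqClosedGraph (g := g) ?_, s, h⟩, fun x => rfl⟩
  intro u x y hu hy
  refine CStarModule.ext_inner_left' (𝔄 := 𝔄) fun z => ?_
  change ⟪z, y⟫_𝔄 = ⟪z, t x⟫_𝔄
  have h1 : Filter.Tendsto (fun n => ⟪z, t (u n)⟫_𝔄) Filter.atTop (nhds ⟪z, y⟫_𝔄) :=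
    ((CStarModule.innerSL (A := 𝔄) z).continuous.tendsto y).comp hy
  have h2 : Filter.Tendsto (fun n => ⟪s z, u n⟫_𝔄) Filter.atTop (nhds ⟪s z, x⟫_𝔄) :=
    ((CStarModule.innerSL (A := 𝔄) (s z)).continuous.tendsto x).comp hu
  simp only [← h'] at h2
  exact tendsto_nhds_unique h1 h2

instance Adjointable.instCompleteSpace [CompleteSpace H] [CompleteSpace K] :
    CompleteSpace (Adjointable 𝔄 H K) := by
  refine Metric.complete_of_cauchySeq_tendsto fun u hu => ?_
  have hu1 : CauchySeq fun n => (u n).1 := hu.map uniformContinuous_subtype_val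
  have hiso : Isometry (Adjointable.adj (𝔄 := 𝔄) (H := H) (K := K)) :=
    Isometry.of_dist_eq fun a b => by
      rw [dist_eq_norm, dist_eq_norm, ← Adjointable.adj_sub]
      exact (a - b).norm_adj
  have hu2 : CauchySeq fun n => (u n).adj.1 :=
    (hu.map hiso.uniformContinuous).map uniformContinuous_subtype_val
  obtain ⟨T, hT⟩ := cauchySeq_tendsto_of_complete hu1
  obtain ⟨S, hS⟩ := cauchySeq_tendsto_of_complete hu2
  refine ⟨⟨T, S, fun x y => ?_⟩, tendsto_subtype_rng.2 hT⟩
  have h1 : Filter.Tendsto (fun n => ⟪y, (u n).1 x⟫_𝔄) Filter.atTop (nhds ⟪y, T x⟫_𝔄) :=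
    ((CStarModule.innerSL (A := 𝔄) y).continuous.tendsto _).comp
      (((ContinuousLinearMap.apply ℂ K x).continuous.tendsto T).comp hT)
  have h2 : Filter.Tendsto (fun n => star ⟪x, (u n).adj.1 y⟫_𝔄) Filter.atTop
      (nhds (star ⟪x, S y⟫_𝔄)) :=
    (continuous_star.tendsto _).comp (((CStarModule.innerSL (A := 𝔄) x).continuous.tendsto _).comp
      (((ContinuousLinearMap.apply ℂ H y).continuous.tendsto S).comp hS))
  have h3 : ∀ n, star ⟪x, (u n).adj.1 y⟫_𝔄 = ⟪y, (u n).1 x⟫_𝔄 := fun n => by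
    rw [← Adjointable.inner_adj, CStarModule.star_inner]
  simp only [h3] at h2
  rw [← CStarModule.star_inner, tendsto_nhds_unique h1 h2, star_star]

end General

/-! ## The C⋆-algebra `𝓛(H)` -/

section Algebra

variable {𝔄 H : Type*} [NonUnitalCStarAlgebra 𝔄] [PartialOrder 𝔄] [StarOrderedRing 𝔄]
  [NormedAddCommGroup H] [NormedSpace ℂ H] [SMul 𝔄 H] [CStarModule 𝔄 H]

instance Adjointable.instMul : Mul (Adjointable 𝔄 H H) := ⟨Adjointable.comp⟩

instance Adjointable.instOne : One (Adjointable 𝔄 H H) := ⟨⟨1, id, fun _ _ => rfl⟩⟩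

instance Adjointable.instStar : Star (Adjointable 𝔄 H H) := ⟨Adjointable.adj⟩

/-- Multiplication in `𝓛(H)` is composition. -/
instance Adjointable.instRing : Ring (Adjointable 𝔄 H H) :=
  { (inferInstance : AddCommGroup (Adjointable 𝔄 H H)),
    (inferInstance : Mul (Adjointable 𝔄 H H)), (inferInstance : One (Adjointable 𝔄 H H)) with
    left_distrib := fun a b c => Subtype.ext (mul_add a.1 b.1 c.1)
    right_distrib := fun a b c => Subtype.ext (add_mul a.1 b.1 c.1)
    zero_mul := fun a => Subtype.ext (zero_mul a.1)
    mul_zero := fun a => Subtype.ext (mul_zero a.1)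
    mul_assoc := fun a b c => Subtype.ext (mul_assoc a.1 b.1 c.1)
    one_mul := fun a => Subtype.ext (one_mul a.1)
    mul_one := fun a => Subtype.ext (mul_one a.1) }

instance Adjointable.instNormedRing : NormedRing (Adjointable 𝔄 H H) :=
  { (inferInstance : NormedAddCommGroup (Adjointable 𝔄 H H)),
    (Adjointable.instRing : Ring (Adjointable 𝔄 H H)) with
    norm_mul_le := fun a b => norm_mul_le a.1 b.1 }

instance Adjointable.instNormedAlgebra : NormedAlgebra ℂ (Adjointable 𝔄 H H) :=
  { Algebra.ofModule (R := ℂ) (A := Adjointable 𝔄 H H)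
      (fun r a b => Subtype.ext (smul_mul_assoc r a.1 b.1))
      (fun r a b => Subtype.ext (mul_smul_comm r a.1 b.1)) with
    norm_smul_le := fun r a => norm_smul_le r a.1 }

/-- The involution of `𝓛(H)` is the adjoint. -/
instance Adjointable.instStarRing : StarRing (Adjointable 𝔄 H H) where
  star_involutive := Adjointable.adj_adj
  star_mul a b := Adjointable.adj_eq fun x y => by
    change ⟪a.1 (b.1 x), y⟫_𝔄 = ⟪x, b.adj.1 (a.adj.1 y)⟫_𝔄
    rw [a.inner_adj, b.inner_adj]
  star_add a b := Adjointable.adj_eq fun x y => by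
    change ⟪a.1 x + b.1 x, y⟫_𝔄 = ⟪x, a.adj.1 y + b.adj.1 y⟫_𝔄
    rw [CStarModule.inner_add_left, CStarModule.inner_add_right, a.inner_adj, b.inner_adj]

instance Adjointable.instCStarAlgebra [CompleteSpace H] : CStarAlgebra (Adjointable 𝔄 H H) where
  norm_mul_self_le a := by
    have key : ‖a.1‖ ≤ √‖star a * a‖ := by
      refine a.1.opNorm_le_bound (Real.sqrt_nonneg _) fun x => ?_
      refine le_of_sq_le_sq ?_ (by positivity)
      calc ‖a.1 x‖ ^ 2 = ‖⟪a.1 x, a.1 x⟫_𝔄‖ := CStarModule.norm_sq_eq 𝔄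
        _ = ‖⟪x, (star a * a).1 x⟫_𝔄‖ := by rw [a.inner_adj]; rfl
        _ ≤ ‖x‖ * ‖(star a * a).1 x‖ := CStarModule.norm_inner_le H
        _ ≤ ‖x‖ * (‖star a * a‖ * ‖x‖) := by
          gcongr; exact (star a * a).1.le_opNorm x
        _ = (√‖star a * a‖ * ‖x‖) ^ 2 := by
          rw [mul_pow, Real.sq_sqrt (norm_nonneg _)]; ring
    calc ‖a‖ * ‖a‖ ≤ √‖star a * a‖ * √‖star a * a‖ := by gcongr <;> exact key
      _ = ‖star a * a‖ := Real.mul_self_sqrt (norm_nonneg _)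
  star_smul c a := Adjointable.adj_eq fun x y => by
    change ⟪c • a.1 x, y⟫_𝔄 = ⟪x, star c • a.adj.1 y⟫_𝔄
    rw [CStarModule.inner_smul_left_complex, CStarModule.inner_smul_right_complex, a.inner_adj]

/-- The usual order of the C⋆-algebra `𝓛(H)`: `a ≤ b` iff `b - a` is a positive element. -/
instance Adjointable.instPartialOrder [CompleteSpace H] : PartialOrder (Adjointable 𝔄 H H) :=
  CStarAlgebra.spectralOrder _

instance Adjointable.instStarOrderedRing [CompleteSpace H] :
    StarOrderedRing (Adjointable 𝔄 H H) :=
  CStarAlgebra.spectralOrderedRing _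

end Algebra

/-! ## Polar decompositions -/

section Polar

variable {𝔄 H K : Type*} [NonUnitalCStarAlgebra 𝔄] [PartialOrder 𝔄] [StarOrderedRing 𝔄]
  [NormedAddCommGroup H] [NormedSpace ℂ H] [SMul 𝔄 H] [CStarModule 𝔄 H]
  [NormedAddCommGroup K] [NormedSpace ℂ K] [SMul 𝔄 K] [CStarModule 𝔄 K]

/-- `U ∈ 𝓛(H, K)` is a partial isometry if `U⋆ U` is a projection of `𝓛(H)`. -/
def Adjointable.IsPartialIsometry (U : Adjointable 𝔄 H K) : Prop :=
  IsStarProjection (U.adj.comp U)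

/-- `P ∈ 𝓛(H)` is the orthogonal projection `P_M` of `H` onto the set `M`: it is idempotent and
self-adjoint with range `M`. Such a `P` exists iff `M` is an orthogonally complemented closed
submodule, and it is then unique. -/
def Adjointable.IsProjectionOnto (P : Adjointable 𝔄 H H) (M : Set H) : Prop :=
  IsStarProjection P ∧ Set.range P.1 = M

/-- `|T| = (T⋆ T)^(1/2) ∈ 𝓛(H)` for `T ∈ 𝓛(H, K)`, the positive square root being taken in the
C⋆-algebra `𝓛(H)`. -/
def Adjointable.abs [CompleteSpace H] (T : Adjointable 𝔄 H K) : Adjointable 𝔄 H H :=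
  CFC.sqrt (T.adj.comp T)

/-- `T = U |T|` is the polar decomposition of `T ∈ 𝓛(H, K)`: the operator `U ∈ 𝓛(H, K)` is a
partial isometry, `T = U |T|`, and `U⋆ U` is the projection onto the closure of the range
of `T⋆`. -/
structure Adjointable.IsPolarDecomposition [CompleteSpace H] (T U : Adjointable 𝔄 H K) :
    Prop where
  isPartialIsometry : U.IsPartialIsometry
  eq_comp_abs : T = U.comp T.abs
  isProjectionOnto : (U.adj.comp U).IsProjectionOnto (closure (Set.range T.adj.1))

/-- `T` has the polar decomposition. -/
def Adjointable.HasPolarDecomposition [CompleteSpace H] (T : Adjointable 𝔄 H K) : Prop :=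
  ∃ U : Adjointable 𝔄 H K, T.IsPolarDecomposition U

end Polar

end

/-! Both implications are instances of one conjugation principle. From `|T| = U_T⋆ T` and `|S⋆| = S
U_S⋆` one gets `Y = U_T⋆ X U_S⋆`, while `T = U_T |T|` and `S = |S⋆| U_S` give back `X = U_T Y U_S`.
So it suffices that a polar decomposition survives `X ↦ W⋆ X Z⋆` when `W⋆` is isometric on the range
of `X` and `Z` on that of `X⋆`; this is `IsPolarDecomposition.conj`. There the modulus becomes `Z
|X| Z⋆`, by uniqueness of positive square roots, and the initial projection becomes `Z U⋆U Z⋆`. The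
cancellations need the fixing conditions on `X` and `X⋆` to pass to `U` and `U⋆U`, which
`comp_polar_eq` and `initial_comp_eq_of_comp_adj_eq` supply by density. -/

namespace Adjointable

/-! ### Algebra of composition and adjoints -/

section Composition

variable {𝔄 H K L M : Type*} [NonUnitalCStarAlgebra 𝔄] [PartialOrder 𝔄] [StarOrderedRing 𝔄]
  [NormedAddCommGroup H] [NormedSpace ℂ H] [SMul 𝔄 H] [CStarModule 𝔄 H]
  [NormedAddCommGroup K] [NormedSpace ℂ K] [SMul 𝔄 K] [CStarModule 𝔄 K]
  [NormedAddCommGroup L] [NormedSpace ℂ L] [SMul 𝔄 L] [CStarModule 𝔄 L]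
  [NormedAddCommGroup M] [NormedSpace ℂ M] [SMul 𝔄 M] [CStarModule 𝔄 M]

theorem comp_assoc (R : Adjointable 𝔄 L M) (T : Adjointable 𝔄 K L) (S : Adjointable 𝔄 H K) :
    (R.comp T).comp S = R.comp (T.comp S) := rfl

theorem comp_apply (T : Adjointable 𝔄 K L) (S : Adjointable 𝔄 H K) (x : H) :
    (T.comp S).1 x = T.1 (S.1 x) := rfl

theorem adj_comp (T : Adjointable 𝔄 K L) (S : Adjointable 𝔄 H K) :
    (T.comp S).adj = S.adj.comp T.adj :=
  adj_eq fun x y => by simp only [comp_apply, inner_adj]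

/-- Operators that agree on the range of `B` agree on every vector in its closure. -/
theorem comp_eq_comp_of_range_subset_closure {F G : Adjointable 𝔄 H K} {B : Adjointable 𝔄 L H}
    {P : Adjointable 𝔄 M H} (h : F.comp B = G.comp B)
    (hP : Set.range P.1 ⊆ closure (Set.range B.1)) : F.comp P = G.comp P := by
  refine Subtype.ext (ContinuousLinearMap.ext fun x => ?_)
  have heq : Set.EqOn F.1 G.1 (Set.range B.1) := by
    rintro _ ⟨y, rfl⟩
    exact congrArg (fun Z : Adjointable 𝔄 L K => Z.1 y) h
  exact heq.closure F.1.continuous G.1.continuous (hP ⟨x, rfl⟩)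

/-- A partial isometry satisfies `U U⋆ U = U`. -/
theorem IsPartialIsometry.comp_adj_comp_self {U : Adjointable 𝔄 H K} (hU : U.IsPartialIsometry) :
    U.comp (U.adj.comp U) = U := by
  refine Subtype.ext (ContinuousLinearMap.ext fun x => ?_)
  have hidem : (U.adj.comp U).1 ((U.adj.comp U).1 x) = (U.adj.comp U).1 x :=
    congrArg (fun Z : Adjointable 𝔄 H H => Z.1 x) hU.isIdempotentElem.eq
  -- With `P = U⋆U` and `v = P x - x`, one has `⟪U v, U v⟫ = ⟪v, P v⟫ = 0`, because `P v = 0`.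
  rw [comp_apply, ← sub_eq_zero, ← map_sub, ← CStarModule.inner_self (A := 𝔄), inner_adj,
    ← comp_apply U.adj U, map_sub, hidem, sub_self, CStarModule.inner_zero_right]

end Composition

/-! ### Moduli and positivity -/

section Polar

variable {𝔄 H K : Type*} [NonUnitalCStarAlgebra 𝔄] [PartialOrder 𝔄] [StarOrderedRing 𝔄]
  [NormedAddCommGroup H] [NormedSpace ℂ H] [SMul 𝔄 H] [CStarModule 𝔄 H] [CompleteSpace H]
  [NormedAddCommGroup K] [NormedSpace ℂ K] [SMul 𝔄 K] [CStarModule 𝔄 K]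

theorem abs_nonneg (T : Adjointable 𝔄 H K) : 0 ≤ T.abs := CFC.sqrt_nonneg _

theorem adj_abs (T : Adjointable 𝔄 H K) : T.abs.adj = T.abs :=
  (IsSelfAdjoint.of_nonneg T.abs_nonneg).star_eq

/-- A conjugate `Z P Z⋆` of a positive operator is positive. -/
theorem comp_comp_adj_nonneg {P : Adjointable 𝔄 H H} (hP : 0 ≤ P) (Z : Adjointable 𝔄 H H) :
    0 ≤ Z.comp (P.comp Z.adj) :=
  star_right_conjugate_nonneg hP Z

/-- The positive square root of `T⋆ T` is unique. -/
theorem abs_eq_of_comp_self {T : Adjointable 𝔄 H K} {B : Adjointable 𝔄 H H}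
    (h : B.comp B = T.adj.comp T) (hB : 0 ≤ B) : T.abs = B :=
  CFC.sqrt_unique h hB

/-- An operator fixing the range of `P²`, with `P` self-adjoint, fixes the range of `P`. -/
theorem comp_eq_self_of_comp_comp_self {P Q : Adjointable 𝔄 H H} (hP : P.adj = P)
    (h : Q.comp (P.comp P) = P.comp P) : Q.comp P = P := by
  have h' : Q * (P * P) = P * P := h
  -- The C⋆-identity reduces the claim to this product, where both factors `P` meet and only `P²`
  -- appears.
  have hz : (Q * P - P) * star (Q * P - P) = 0 := by
    have hP' : star P = P := hP
    calc (Q * P - P) * star (Q * P - P) = (Q * (P * P) - P * P) * star Q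
          - (Q * (P * P) - P * P) := by
            rw [star_sub, star_mul, hP']; noncomm_ring
      _ = 0 := by rw [h', sub_self, zero_mul, sub_zero]
  exact sub_eq_zero.1 ((CStarRing.mul_star_self_eq_zero_iff _).1 hz)

/-! ### Identities satisfied by a polar decomposition -/

namespace IsPolarDecomposition

variable {T U : Adjointable 𝔄 H K}

theorem adj_eq_abs_comp (h : T.IsPolarDecomposition U) : T.adj = T.abs.comp U.adj := by
  conv_lhs => rw [h.eq_comp_abs]
  rw [adj_comp, adj_abs]

/-- `|T|² = T⋆ T`. -/
theorem abs_comp_abs (h : T.IsPolarDecomposition U) : T.abs.comp T.abs = T.adj.comp T := by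
  -- The square root squares back only for a positive element. As `T` need not lie in `𝓛(H)`,
  -- positivity is read off from `T⋆T = |T| (U⋆U) |T|`, a conjugate of a projection.
  refine CFC.sqrt_mul_sqrt_self (T.adj.comp T) ?_
  have hpos := comp_comp_adj_nonneg h.isPartialIsometry.nonneg T.abs
  have heq : T.adj.comp T = T.abs.comp ((U.adj.comp U).comp T.abs.adj) := by
    conv_lhs => rw [h.adj_eq_abs_comp]; rhs; rw [h.eq_comp_abs]
    rw [adj_abs]; rfl
  rwa [heq]

/-- `U⋆ U` fixes the range of `T⋆`. -/
theorem initial_comp_adj (h : T.IsPolarDecomposition U) : (U.adj.comp U).comp T.adj = T.adj := by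
  refine Subtype.ext (ContinuousLinearMap.ext fun x => ?_)
  have hx : T.adj.1 x ∈ Set.range (U.adj.comp U).1 := by
    rw [h.isProjectionOnto.2]
    exact subset_closure ⟨x, rfl⟩
  obtain ⟨y, hy⟩ := hx
  rw [comp_apply, ← hy]
  exact congrArg (fun Z : Adjointable 𝔄 H H => Z.1 y) h.isPartialIsometry.isIdempotentElem.eq

/-- `U⋆ U |T| = |T|`. -/
theorem initial_comp_abs (h : T.IsPolarDecomposition U) : (U.adj.comp U).comp T.abs = T.abs := by
  refine comp_eq_self_of_comp_comp_self T.adj_abs ?_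
  rw [h.abs_comp_abs, ← comp_assoc, h.initial_comp_adj]

/-- `T U⋆ U = T`. -/
theorem comp_initial (h : T.IsPolarDecomposition U) : T.comp (U.adj.comp U) = T := by
  simpa only [adj_comp, adj_adj] using congrArg adj h.initial_comp_adj

/-- `|T| = U⋆ T`. -/
theorem abs_eq_adj_comp (h : T.IsPolarDecomposition U) : T.abs = U.adj.comp T := by
  conv_rhs => rw [h.eq_comp_abs]
  rw [← comp_assoc, h.initial_comp_abs]

/-- `|T| = T⋆ U`. -/
theorem abs_eq_adj_comp' (h : T.IsPolarDecomposition U) : T.abs = T.adj.comp U := by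
  have := congrArg adj h.abs_eq_adj_comp
  rwa [adj_abs, adj_comp, adj_adj] at this

/-- `U U⋆` fixes the range of `T`. -/
theorem final_comp_self (h : T.IsPolarDecomposition U) : U.comp (U.adj.comp T) = T := by
  rw [← h.abs_eq_adj_comp, ← h.eq_comp_abs]

/-- The range of `U⋆U` is the closure of that of `T⋆`, so continuity carries the identity over. -/
theorem initial_comp_eq_of_comp_adj_eq (h : T.IsPolarDecomposition U)
    {L : Type*} [NormedAddCommGroup L] [NormedSpace ℂ L] [SMul 𝔄 L] [CStarModule 𝔄 L]
    {F G : Adjointable 𝔄 H L} (hFG : F.comp T.adj = G.comp T.adj) :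
    F.comp (U.adj.comp U) = G.comp (U.adj.comp U) :=
  comp_eq_comp_of_range_subset_closure hFG h.isProjectionOnto.2.le

/-- An operator fixing the range of `T` fixes the range of its polar factor. -/
theorem comp_polar_eq (h : T.IsPolarDecomposition U) {Q : Adjointable 𝔄 K K}
    (hQ : Q.comp T = T) : Q.comp U = U := by
  -- `Q U` and `U` agree on `|T|`, hence on `T⋆ = |T| U⋆`, hence after `U⋆U`; then `U U⋆U = U`.
  have h1 : (Q.comp U).comp T.adj = U.comp T.adj := by
    have h2 : (Q.comp U).comp T.abs = U.comp T.abs := by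
      rw [comp_assoc, ← h.eq_comp_abs, hQ]
    rw [h.adj_eq_abs_comp, ← comp_assoc, h2, comp_assoc]
  have h3 := h.initial_comp_eq_of_comp_adj_eq h1
  rwa [comp_assoc, h.isPartialIsometry.comp_adj_comp_self] at h3

end IsPolarDecomposition

/-- `|S⋆| = S U⋆` for `S ∈ 𝓛(H)` with polar decomposition `S = U |S|`. -/
theorem IsPolarDecomposition.abs_adj_eq_comp_adj {S U : Adjointable 𝔄 H H}
    (h : S.IsPolarDecomposition U) : S.adj.abs = S.comp U.adj := by
  refine abs_eq_of_comp_self ?_ ?_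
  · calc (S.comp U.adj).comp (S.comp U.adj) = S.comp ((U.adj.comp S).comp U.adj) := rfl
      _ = S.comp S.adj := by rw [← h.abs_eq_adj_comp, ← h.adj_eq_abs_comp]
      _ = S.adj.adj.comp S.adj := by rw [adj_adj]
  -- Positivity comes from `S U⋆ = U |S| U⋆`.
  · have hpos := comp_comp_adj_nonneg S.abs_nonneg U
    rwa [← comp_assoc, ← h.eq_comp_abs] at hpos

/-! ### Conjugation of polar decompositions -/

/-- Polar decompositions are transported by `X ↦ W⋆ X Z⋆` when `W W⋆` fixes the range of `X` and
`Z⋆ Z` fixes the range of `X⋆`. -/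
theorem IsPolarDecomposition.conj {X U : Adjointable 𝔄 H K} (h : X.IsPolarDecomposition U)
    {W : Adjointable 𝔄 K K} {Z : Adjointable 𝔄 H H} (hW : W.comp (W.adj.comp X) = X)
    (hZ : Z.adj.comp (Z.comp X.adj) = X.adj) :
    (W.adj.comp (X.comp Z.adj)).IsPolarDecomposition (W.adj.comp (U.comp Z.adj)) := by
  set P := U.adj.comp U
  have hWU : W.comp (W.adj.comp U) = U := h.comp_polar_eq (Q := W.comp W.adj) hW
  have hXW : X.adj.comp (W.comp W.adj) = X.adj := by
    simpa only [adj_comp, adj_adj, comp_assoc] using congrArg adj hW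
  have hZP : Z.adj.comp (Z.comp P) = P := by
    have hid : (1 : Adjointable 𝔄 H H).comp P = P := one_mul P
    have := h.initial_comp_eq_of_comp_adj_eq (F := Z.adj.comp Z) (G := 1)
      (hZ.trans (Subtype.ext (ContinuousLinearMap.ext fun _ => rfl)))
    rwa [hid] at this
  have hZabs : Z.adj.comp (Z.comp X.abs) = X.abs := by
    rw [h.abs_eq_adj_comp', ← comp_assoc, ← comp_assoc, comp_assoc Z.adj, hZ]
  have hPP : P.comp P = P := h.isPartialIsometry.isIdempotentElem.eq
  have hinit : (W.adj.comp (U.comp Z.adj)).adj.comp (W.adj.comp (U.comp Z.adj))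
      = Z.comp (P.comp Z.adj) := by
    calc _ = Z.comp (U.adj.comp ((W.comp (W.adj.comp U)).comp Z.adj)) := by
          simp only [adj_comp, adj_adj, comp_assoc]
      _ = _ := by rw [hWU]; rfl
  have hYadj : (W.adj.comp (X.comp Z.adj)).adj = Z.comp (X.adj.comp W) := by
    simp only [adj_comp, adj_adj, comp_assoc]
  have habs : (W.adj.comp (X.comp Z.adj)).abs = Z.comp (X.abs.comp Z.adj) := by
    refine abs_eq_of_comp_self ?_ (comp_comp_adj_nonneg X.abs_nonneg Z)
    calc (Z.comp (X.abs.comp Z.adj)).comp (Z.comp (X.abs.comp Z.adj))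
        = Z.comp (X.abs.comp ((Z.adj.comp (Z.comp X.abs)).comp Z.adj)) := rfl
      _ = Z.comp ((X.abs.comp X.abs).comp Z.adj) := by rw [hZabs, comp_assoc]
      _ = Z.comp ((X.adj.comp (W.comp (W.adj.comp X))).comp Z.adj) := by
          rw [h.abs_comp_abs, hW]
      _ = _ := by rw [hYadj]; rfl
  have hproj : IsStarProjection (Z.comp (P.comp Z.adj)) := by
    refine ⟨?_, ?_⟩
    · calc (Z.comp (P.comp Z.adj)).comp (Z.comp (P.comp Z.adj))
          = Z.comp (P.comp ((Z.adj.comp (Z.comp P)).comp Z.adj)) := rfl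
        _ = Z.comp ((P.comp P).comp Z.adj) := by rw [hZP]; rfl
        _ = _ := by rw [hPP]
    · exact IsSelfAdjoint.of_nonneg (comp_comp_adj_nonneg h.isPartialIsometry.nonneg Z)
  refine ⟨?_, ?_, ?_, ?_⟩
  · rwa [IsPartialIsometry, hinit]
  · calc W.adj.comp (X.comp Z.adj)
        = W.adj.comp (U.comp ((Z.adj.comp (Z.comp X.abs)).comp Z.adj)) := by
          rw [hZabs, ← comp_assoc U, ← h.eq_comp_abs]
      _ = _ := by rw [habs]; rfl
  · rwa [hinit]
  · rw [hinit, hYadj]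
    refine subset_antisymm ?_ ?_
    · rintro _ ⟨x, rfl⟩
      have hx : P.1 (Z.adj.1 x) ∈ closure (Set.range X.adj.1) := by
        rw [← h.isProjectionOnto.2]
        exact ⟨_, rfl⟩
      change Z.1 (P.1 (Z.adj.1 x)) ∈ _
      -- It remains to see that `Z` sends the range of `X⋆` into that of `Z X⋆ W`: since `X⋆ = X⋆ W
      -- W⋆`, the vector `W⋆ y` is a preimage of `Z X⋆ y`.
      refine map_mem_closure Z.1.continuous hx ?_
      rintro _ ⟨y, rfl⟩
      exact ⟨W.adj.1 y, congrArg (fun V : Adjointable 𝔄 K H => Z.1 (V.1 y)) hXW⟩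
    -- The range of an idempotent is its fixed-point set, hence closed, so it is enough that `Z P
    -- Z⋆` fixes the range of `Z X⋆ W`.
    · have hclosed : IsClosed (Set.range (Z.comp (P.comp Z.adj)).1) := by
        have hfix : Set.range (Z.comp (P.comp Z.adj)).1
            = {x | (Z.comp (P.comp Z.adj)).1 x = x} := by
          ext x
          refine ⟨?_, fun hx => ⟨x, hx⟩⟩
          rintro ⟨y, rfl⟩
          exact congrArg (fun V : Adjointable 𝔄 H H => V.1 y) hproj.isIdempotentElem.eq
        rw [hfix]
        exact isClosed_eq (Z.comp (P.comp Z.adj)).1.continuous continuous_id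
      refine closure_minimal ?_ hclosed
      have heq : (Z.comp (P.comp Z.adj)).comp (Z.comp (X.adj.comp W))
          = Z.comp (X.adj.comp W) := by
        calc (Z.comp (P.comp Z.adj)).comp (Z.comp (X.adj.comp W))
            = Z.comp (P.comp ((Z.adj.comp (Z.comp X.adj)).comp W)) := rfl
          _ = Z.comp ((P.comp X.adj).comp W) := by rw [hZ]; rfl
          _ = _ := by rw [h.initial_comp_adj]
      rintro _ ⟨x, rfl⟩
      exact ⟨_, congrArg (fun V : Adjointable 𝔄 K H => V.1 x) heq⟩

end Polar

end Adjointable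

/-! ### The two transfers between `X` and `Y` -/

theorem theorem2p4 {𝔄 H K : Type*}
    [NonUnitalCStarAlgebra 𝔄] [PartialOrder 𝔄] [StarOrderedRing 𝔄]
    [NormedAddCommGroup H] [NormedSpace ℂ H] [SMul 𝔄 H] [CStarModule 𝔄 H] [CompleteSpace H]
    [NormedAddCommGroup K] [NormedSpace ℂ K] [SMul 𝔄 K] [CStarModule 𝔄 K] [CompleteSpace K]
    (T U_T : Adjointable 𝔄 K K) (S U_S : Adjointable 𝔄 H H)
    (hT : T.IsPolarDecomposition U_T) (hS : S.IsPolarDecomposition U_S)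
    (A X Y : Adjointable 𝔄 H K)
    (hX : X = T.comp (A.comp S)) (hY : Y = T.abs.comp (A.comp S.adj.abs)) :
    (∀ U_X : Adjointable 𝔄 H K, X.IsPolarDecomposition U_X →
      Y.IsPolarDecomposition (U_T.adj.comp (U_X.comp U_S.adj))) ∧
    (∀ U_Y : Adjointable 𝔄 H K, Y.IsPolarDecomposition U_Y →
      X.IsPolarDecomposition (U_T.comp (U_Y.comp U_S))) ∧
    (X.HasPolarDecomposition ↔ Y.HasPolarDecomposition) := by
  have hTU := hT.abs_eq_adj_comp
  have hSU := hS.abs_adj_eq_comp_adj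
  have hSS : S.adj.abs.comp U_S = S := by
    rw [hSU, Adjointable.comp_assoc]
    exact hS.comp_initial
  have hYX : Y = U_T.adj.comp (X.comp U_S.adj) := by
    rw [hY, hX, hTU, hSU]; rfl
  have hXY : X = U_T.comp (Y.comp U_S) := by
    calc X = (U_T.comp T.abs).comp (A.comp (S.adj.abs.comp U_S)) := by
          rw [hX, ← hT.eq_comp_abs, hSS]
      _ = _ := by rw [hY]; rfl
  have h₁ : ∀ U_X : Adjointable 𝔄 H K, X.IsPolarDecomposition U_X →
      Y.IsPolarDecomposition (U_T.adj.comp (U_X.comp U_S.adj)) := by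
    intro U_X h
    rw [hYX]
    refine h.conj ?_ ?_
    · calc U_T.comp (U_T.adj.comp X) = (U_T.comp (U_T.adj.comp T)).comp (A.comp S) := by
            rw [hX]; rfl
        _ = X := by rw [hT.final_comp_self, hX]
    · have hXadj : X.adj = S.adj.comp (A.adj.comp T.adj) := by
        rw [hX]; simp only [Adjointable.adj_comp, Adjointable.comp_assoc]
      calc U_S.adj.comp (U_S.comp X.adj)
          = ((U_S.adj.comp U_S).comp S.adj).comp (A.adj.comp T.adj) := by rw [hXadj]; rfl
        _ = X.adj := by rw [hS.initial_comp_adj, hXadj]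
  have h₂ : ∀ U_Y : Adjointable 𝔄 H K, Y.IsPolarDecomposition U_Y →
      X.IsPolarDecomposition (U_T.comp (U_Y.comp U_S)) := by
    intro U_Y h
    -- The way back uses the adjoint partial isometries: now `U_T⋆ U_T` must fix the range of `|T|`,
    -- and `U_S U_S⋆` that of `|S⋆| = S U_S⋆`.
    have := h.conj (W := U_T.adj) (Z := U_S.adj) ?_ ?_
    · rwa [Adjointable.adj_adj, Adjointable.adj_adj, ← hXY] at this
    · calc U_T.adj.comp (U_T.adj.adj.comp Y)
          = ((U_T.adj.comp U_T).comp T.abs).comp (A.comp S.adj.abs) := by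
            rw [Adjointable.adj_adj, hY]; rfl
        _ = Y := by rw [hT.initial_comp_abs, hY]
    · have hYadj : Y.adj = S.adj.abs.comp (A.adj.comp T.abs) := by
        rw [hY]; simp only [Adjointable.adj_comp, Adjointable.adj_abs, Adjointable.comp_assoc]
      calc U_S.adj.adj.comp (U_S.adj.comp Y.adj)
          = ((U_S.comp (U_S.adj.comp S)).comp U_S.adj).comp (A.adj.comp T.abs) := by
            rw [Adjointable.adj_adj, hYadj, hSU]; rfl
        _ = Y.adj := by rw [hS.final_comp_self, hYadj, hSU]
  exact ⟨h₁, h₂, fun ⟨U, h⟩ => ⟨_, h₁ U h⟩, fun ⟨U, h⟩ => ⟨_, h₂ U h⟩⟩
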